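/- Let $F$ be a field whose algebraic closure $\overline{F}$ is a finite extension of $F$, and let $n \ge 3$ be an integer. Let $\Gamma(M_n(F))$ be the commuting graph of the ring $M_n(F)$ of $n\times n$ matrices over $F$: its vertices are the non-central matrices in $M_n(F)$, and two distinct vertices $A$ and $B$ are adjacent if and only if $AB = BA$. Then $\Gamma(M_n(F))$ is connected and its diameter (the supremum of the distances between two vertices) is equal to $4$. -/

import Mathlib

/-- The commuting graph of a ring `R`: the vertices are the non-central elements of `R`, and two
distinct vertices are adjacent if and only if they commute. -/
def commutingGraph (R : Type*) [Ring R] : SimpleGraph {a : R // a ∉ Subring.center R} where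
  Adj a b := a ≠ b ∧ (a : R) * (b : R) = (b : R) * (a : R)
  symm := ⟨fun _ _ h => ⟨h.1.symm, h.2.symm⟩⟩
  loopless := ⟨fun _ h => h.1 rfl⟩

/-! Upper bound: by the Artin–Schreier theorem the algebraic closure `L` is `F(i)` with `i ^ 2 =
-1`, so `[L : F] ≤ 2` (`IntermediateField.adjoin_sqrt_neg_one_eq_top`). A matrix with an eigenvalue
in `F` commutes with a rank-one matrix, built from a right and a left eigenvector. Otherwise its
characteristic polynomial has no root in `F`, hence divides some `q ^ 2 + 1`, and `J = q(A)`
satisfies `J ^ 2 = -1` by Cayley–Hamilton; in this case `-1` is not a square in `F`. Any two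
matrices of these kinds, rank one or complex structure, have a common noncentral commuting matrix
once `n ≥ 3`. This gives paths `A – X – Z – Y – B`.

Lower bound: the centralizers of the nilpotent Jordan block and of its transpose consist of upper
and lower triangular Toeplitz matrices. Noncentral members of the two never commute
(`Matrix.not_commute_of_commute_upperShift`), so these two vertices are at distance at least 4. -/

open Polynomial

/-! ### Artin–Schreier: automorphisms of prime order -/

/-- An algebraically closed field of characteristic `p` has no automorphism of order `p`. -/
theorem RingAut.not_orderOf_eq_char {C : Type*} [Field C] [IsAlgClosed C] {p : ℕ}
    [hp : Fact p.Prime] [CharP C p] (σ : RingAut C) : orderOf σ ≠ p := by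
  intro hσ
  let : Algebra (ZMod p) C := ZMod.algebra C p
  have hchar : CharP (Module.End (ZMod p) C) p :=
    charP_of_injective_algebraMap (algebraMap (ZMod p) (Module.End (ZMod p) C)).injective p
  let s : Module.End (ZMod p) C := AddMonoidHom.toZModLinearMap p (σ : C →+ C)
  have hs_pow : ∀ k x, (s ^ k) x = (σ ^ k) x := by
    intro k
    induction k with
    | zero => intro x; rfl
    | succ k ih => intro x; rw [pow_succ, pow_succ]; exact ih (σ x)
  let D : Module.End (ZMod p) C := s - 1
  have hD : ∀ x, D x = σ x - x := fun _ => rfl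
  have hDp : D ^ p = 0 := by
    rw [sub_pow_char_of_commute p (Commute.one_right s), one_pow, sub_eq_zero]
    ext x
    rw [hs_pow, orderOf_dvd_iff_pow_eq_one.1 hσ.dvd]
    rfl
  have hD0 : D ≠ 0 := by
    intro h
    have : σ = 1 := by
      ext x
      have := LinearMap.congr_fun h x
      rw [hD] at this
      exact sub_eq_zero.1 this
    rw [this, orderOf_one] at hσ
    exact hp.out.one_lt.ne hσ
  -- `D` is nilpotent; its last nonzero power `D ^ (m + 1)` takes values in the fixed field.
  obtain ⟨m, hm, hm'⟩ : ∃ m, D ^ (m + 1) ≠ 0 ∧ D ^ (m + 2) = 0 := by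
    by_contra! h
    have : ∀ m, D ^ (m + 1) ≠ 0 := by
      intro m
      induction m with
      | zero => simpa using hD0
      | succ m ih => exact h m ih
    exact this (p - 1) (by rwa [Nat.sub_add_cancel hp.out.one_le])
  have hlin : ∀ k (t : C), σ t = t → ∀ x, (D ^ k) (t * x) = t * (D ^ k) x := by
    intro k t ht
    induction k with
    | zero => intro x; rfl
    | succ k ih =>
      intro x
      rw [pow_succ, Module.End.mul_apply, Module.End.mul_apply, ← ih, hD, hD, map_mul, ht]
      congr 1; ring
  have hwp : ∀ k x, (D ^ k) (x ^ p - x) = ((D ^ k) x) ^ p - (D ^ k) x := by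
    intro k
    induction k with
    | zero => intro x; rfl
    | succ k ih =>
      intro x
      rw [pow_succ, Module.End.mul_apply, Module.End.mul_apply, ← ih, hD, hD, map_sub σ,
        map_pow σ, sub_pow_char]
      congr 1; ring
  -- `D ^ (m + 1)` is linear over the fixed field and nonzero, so it maps onto that field.
  have hsurj : ∀ c : C, σ c = c → ∃ x, (D ^ (m + 1)) x = c := by
    intro c hc
    obtain ⟨x, hx⟩ : ∃ x, (D ^ (m + 1)) x ≠ 0 := by
      by_contra! h
      exact hm (LinearMap.ext h)
    have ht : σ ((D ^ (m + 1)) x) = (D ^ (m + 1)) x := by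
      have : D ((D ^ (m + 1)) x) = 0 := by
        rw [← Module.End.mul_apply, ← pow_succ', hm']
        rfl
      rwa [hD, sub_eq_zero] at this
    refine ⟨c / (D ^ (m + 1)) x * x, ?_⟩
    rw [hlin _ _ (by rw [map_div₀, hc, ht]), div_mul_cancel₀ _ hx]
  have hroot : ∀ c : C, ∃ u : C, u ^ p - u = c := by
    intro c
    have hdeg : (X ^ p - X - Polynomial.C c).degree ≠ 0 := by
      have h1 := FiniteField.X_pow_card_sub_X_natDegree_eq C hp.out.one_lt
      have h2 : (X ^ p - X - Polynomial.C c : C[X]).natDegree = p := by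
        rw [natDegree_sub_C, h1]
      intro h
      rw [natDegree_eq_of_degree_eq_some h] at h2
      exact hp.out.ne_zero h2.symm
    obtain ⟨u, hu⟩ := IsAlgClosed.exists_root _ hdeg
    refine ⟨u, ?_⟩
    simpa [sub_eq_zero] using hu
  obtain ⟨w, hw⟩ := hsurj 1 (map_one σ)
  set y := (D ^ m) w with hy
  have hDy : D y = 1 := by rw [hy, ← Module.End.mul_apply, ← pow_succ', hw]
  -- Solve `u ^ p - u = z` in `C` and push `u` down by `D ^ (m + 1)`, which commutes with `x ↦ x ^ p
  -- - x`. Then `y - b` lies in the prime field, although `D (y - b) = 1`.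
  obtain ⟨b, hb, hby⟩ : ∃ b, σ b = b ∧ b ^ p - b = y ^ p - y := by
    have hfix : σ (y ^ p - y) = y ^ p - y := by
      have h1 : D (y ^ p - y) = 0 := by
        have := hwp 1 y
        rw [pow_one, hDy] at this
        simpa using this
      rwa [hD, sub_eq_zero] at h1
    obtain ⟨z, hz⟩ := hsurj _ hfix
    obtain ⟨u, rfl⟩ := hroot z
    rw [hwp] at hz
    refine ⟨_, ?_, hz⟩
    have : D ((D ^ (m + 1)) u) = 0 := by
      rw [← Module.End.mul_apply, ← pow_succ', hm']
      rfl
    rwa [hD, sub_eq_zero] at this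
  have hprime : y - b ∈ (⊥ : Subfield C) := by
    rw [Subfield.mem_bot_iff_pow_eq_self C p, sub_pow_char]
    linear_combination -hby
  have hfix : σ (y - b) = y - b := by
    have hle : (⊥ : Subfield C) ≤ (RingHom.eqLocusField (σ : C →+* C) (RingHom.id C)) := bot_le
    exact hle hprime
  have h1 : σ y - y = 1 := hDy
  rw [map_sub, hb] at hfix
  exact one_ne_zero (α := C) (by linear_combination -h1 + hfix)

/-- An automorphism of prime order `p` of an algebraically closed field of characteristic other
than `p` does not fix a square root of `-1`. -/
theorem RingAut.apply_ne_of_orderOf_eq_prime {C : Type*} [Field C] [IsAlgClosed C] {p : ℕ}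
    [hp : Fact p.Prime] (hC : (p : C) ≠ 0) (σ : RingAut C) (hσ : orderOf σ = p)
    {i : C} (hi : i * i = -1) : σ i ≠ i := by
  intro hσi
  have : NeZero (p : C) := ⟨hC⟩
  have hσp : ∀ x, (σ ^ p) x = x := by
    intro x; rw [← hσ, pow_orderOf_eq_one]; rfl
  obtain ⟨ζ, hζ⟩ := HasEnoughRootsOfUnity.exists_primitiveRoot C p
  -- If `σ ζ = ζ ^ k`, then `ζ = σ ^ p ζ = ζ ^ (k ^ p) = ζ ^ k` by Fermat.
  have hζσ : σ ζ = ζ := by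
    obtain ⟨k, -, hk⟩ := hζ.eq_pow_of_pow_eq_one (ξ := σ ζ) (by
      rw [← map_pow, hζ.pow_eq_one, map_one])
    have hit : ∀ j, (σ ^ j) ζ = ζ ^ (k ^ j) := by
      intro j
      induction j with
      | zero => simp
      | succ j ih =>
        rw [pow_succ', RingAut.mul_apply, ih, map_pow, ← hk, ← pow_mul, pow_succ']
    have h1 := hit p
    rw [hσp] at h1
    have h2 : k ^ p ≡ k [MOD p] := by
      rw [← ZMod.natCast_eq_natCast_iff]
      push_cast
      exact ZMod.pow_card _
    have h3 : ζ ^ (k ^ p) = ζ ^ k := by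
      exact pow_eq_pow_of_modEq h2 hζ.pow_eq_one
    rw [← hk, ← h3, ← h1]
  -- A Lagrange resolvent, nonzero for some `x` by Dedekind's independence of characters.
  obtain ⟨γ, hγ0, hγ⟩ : ∃ γ : C, γ ≠ 0 ∧ σ γ = ζ * γ := by
    have hinj : Function.Injective
        (fun j : Fin p => ((σ ^ (j : ℕ) : RingAut C) : C →* C)) := by
      intro a b hab
      have : σ ^ (a : ℕ) = σ ^ (b : ℕ) := by
        ext x
        exact DFunLike.congr_fun hab x
      rw [pow_inj_mod, hσ, Nat.mod_eq_of_lt a.2, Nat.mod_eq_of_lt b.2] at this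
      exact Fin.ext this
    have hli := (linearIndependent_monoidHom C C).comp _ hinj
    rw [Fintype.linearIndependent_iff] at hli
    obtain ⟨x, hx⟩ : ∃ x : C, ∑ j : Fin p, ζ⁻¹ ^ (j : ℕ) * (σ ^ (j : ℕ)) x ≠ 0 := by
      by_contra! h
      have := hli (fun j => ζ⁻¹ ^ (j : ℕ)) (by
        ext x
        simpa using h x) ⟨0, hp.out.pos⟩
      simp at this
    rw [Fin.sum_univ_eq_sum_range (fun j => ζ⁻¹ ^ j * (σ ^ j) x)] at hx
    refine ⟨_, hx, ?_⟩
    have hζ0 : ζ ≠ 0 := hζ.ne_zero hp.out.ne_zero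
    have h1 : ∀ j, σ (ζ⁻¹ ^ j * (σ ^ j) x) = ζ * (ζ⁻¹ ^ (j + 1) * (σ ^ (j + 1)) x) := by
      intro j
      rw [map_mul, map_pow, map_inv₀, hζσ, pow_succ' σ, RingAut.mul_apply, pow_succ']
      field_simp
    rw [map_sum, Finset.sum_congr rfl fun j _ => h1 j, ← Finset.mul_sum]
    congr 1
    have h2 := Finset.sum_range_succ (fun j => ζ⁻¹ ^ j * (σ ^ j) x) p
    rw [Finset.sum_range_succ'] at h2
    simpa [hσp, hζ.pow_eq_one] using h2
  have hζ1 : ζ ≠ 1 := hζ.ne_one hp.out.one_lt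
  have hne : σ γ ≠ γ := by
    rw [hγ]
    intro h
    exact hζ1 (mul_right_cancel₀ hγ0 (by rw [h, one_mul]))
  obtain ⟨β, hβ⟩ := IsAlgClosed.exists_pow_nat_eq γ hp.out.pos
  have hβ0 : β ≠ 0 := by
    rintro rfl
    rw [zero_pow hp.out.ne_zero] at hβ
    exact hγ0 hβ.symm
  let N : C → C := fun x => ∏ j ∈ Finset.range p, (σ ^ j) x
  have hNfix : ∀ x, x ≠ 0 → σ (N x) = N x := by
    intro x hx
    have h2 := Finset.prod_range_succ (fun j => (σ ^ j) x) p
    rw [Finset.prod_range_succ', hσp, pow_zero, RingAut.one_apply] at h2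
    have h3 := mul_right_cancel₀ hx h2
    change σ (∏ j ∈ Finset.range p, (σ ^ j) x) = ∏ j ∈ Finset.range p, (σ ^ j) x
    rw [map_prod, ← h3]
    refine Finset.prod_congr rfl fun j _ => ?_
    rw [pow_succ', RingAut.mul_apply]
  have hNγ : N γ = ζ ^ (∑ j ∈ Finset.range p, j) * γ ^ p := by
    have : ∀ j, (σ ^ j) γ = ζ ^ j * γ := by
      intro j
      induction j with
      | zero => simp
      | succ j ih =>
        rw [pow_succ', RingAut.mul_apply, ih, map_mul, map_pow, hζσ, hγ, pow_succ]; ring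
    change ∏ j ∈ Finset.range p, (σ ^ j) γ = _
    rw [Finset.prod_congr rfl fun j _ => this j, Finset.prod_mul_distrib,
      Finset.prod_pow_eq_pow_sum, Finset.prod_const, Finset.card_range]
  have hNβ : N β ^ p = N γ := by
    change (∏ j ∈ Finset.range p, (σ ^ j) β) ^ p = ∏ j ∈ Finset.range p, (σ ^ j) γ
    rw [← Finset.prod_pow]
    refine Finset.prod_congr rfl fun j _ => ?_
    rw [← hβ, map_pow]
  -- `N β ^ p = ζ ^ (p(p-1)/2) * γ ^ p`. The root of unity is `1` for odd `p` and `-1` for `p = 2`;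
  -- only the latter needs `i` to be fixed. As `N β` and `e` are fixed, so is `γ`, a contradiction.
  obtain ⟨e, he, heγ⟩ : ∃ e : C, σ e = e ∧ N β = e * γ := by
    rcases hp.out.eq_two_or_odd' with h2 | hodd
    · subst h2
      have hm : ζ = -1 := hζ.eq_neg_one_of_two_right
      have : (N β - i * γ) * (N β + i * γ) = 0 := by
        have h1 : N β ^ 2 = -γ ^ 2 := by
          rw [hNβ, hNγ, hm]
          simp [Finset.sum_range_succ]
        linear_combination h1 - γ ^ 2 * hi
      rcases mul_eq_zero.1 this with h | h
      · exact ⟨i, hσi, by linear_combination h⟩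
      · exact ⟨-i, by rw [map_neg, hσi], by linear_combination h⟩
    · have h1 : (N β / γ) ^ p = 1 := by
        obtain ⟨k, hk⟩ := hodd
        have : ζ ^ (∑ j ∈ Finset.range p, j) = 1 := by
          rw [hζ.pow_eq_one_iff_dvd, Finset.sum_range_id]
          refine ⟨k, ?_⟩
          have h3 : p - 1 = k * 2 := by omega
          rw [h3, ← mul_assoc, Nat.mul_div_cancel _ two_pos]
        rw [div_pow, hNβ, hNγ, this, one_mul, div_self (pow_ne_zero _ hγ0)]
      obtain ⟨k, -, hk⟩ := hζ.eq_pow_of_pow_eq_one h1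
      exact ⟨ζ ^ k, by rw [map_pow, hζσ], by rw [hk, div_mul_cancel₀ _ hγ0]⟩
  have hN0 : N β ≠ 0 := Finset.prod_ne_zero_iff.2 fun j _ =>
    (map_ne_zero_iff _ (σ ^ j).injective).2 hβ0
  have he0 : e ≠ 0 := by
    rintro rfl
    rw [zero_mul] at heγ
    exact hN0 heγ
  apply hne
  have h1 := hNfix β hβ0
  rw [heγ, map_mul, he] at h1
  exact mul_left_cancel₀ he0 h1

/-- An automorphism of an algebraically closed field fixing a square root of `-1` does not have
prime order. -/
theorem RingAut.orderOf_ne_prime_of_apply_eq {C : Type*} [Field C] [IsAlgClosed C]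
    (σ : RingAut C) {p : ℕ} (hp : p.Prime) {i : C} (hi : i * i = -1) (hσi : σ i = i) :
    orderOf σ ≠ p := by
  intro hσ
  have := Fact.mk hp
  by_cases hC : (p : C) = 0
  · have : CharP C p := (CharP.charP_iff_prime_eq_zero hp).2 hC
    exact RingAut.not_orderOf_eq_char σ hσ
  · exact RingAut.apply_ne_of_orderOf_eq_prime hC σ hσ hi hσi

/-! ### Subfields of finite codegree in an algebraically closed field -/

open IntermediateField in
/-- An algebraically closed field is separable over every subfield of finite codegree. -/
theorem Algebra.IsSeparable.of_finiteDimensional_of_isAlgClosed (F L : Type*) [Field F] [Field L]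
    [Algebra F L] [FiniteDimensional F L] [IsAlgClosed L] : Algebra.IsSeparable F L := by
  rw [← separableClosure.eq_top_iff, _root_.eq_top_iff]
  rintro x -
  obtain ⟨q, hq⟩ := ExpChar.exists (separableClosure F L)
  -- `L` is purely inseparable of finite exponent over the separable closure, and every `x` is a
  -- power of that exponent.
  obtain ⟨z, rfl⟩ := IsAlgClosed.exists_pow_nat_eq x
    (pow_pos (expChar_pos (separableClosure F L) q)
      (IsPurelyInseparable.exponent (separableClosure F L) L))
  obtain ⟨y, hy⟩ := IsPurelyInseparable.exponent_def' (separableClosure F L) q z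
  rw [← hy]
  exact y.2

open IntermediateField in
/-- A subfield of finite codegree in an algebraically closed field generates it together with a
square root of `-1`. -/
theorem IntermediateField.adjoin_sqrt_neg_one_eq_top {F L : Type*} [Field F] [Field L]
    [Algebra F L] [FiniteDimensional F L] [IsAlgClosed L] {i : L} (hi : i * i = -1) :
    F⟮i⟯ = ⊤ := by
  have := Algebra.IsSeparable.of_finiteDimensional_of_isAlgClosed F⟮i⟯ L
  have : Normal F⟮i⟯ L := ⟨fun x => IsAlgClosed.splits _⟩
  have : IsGalois F⟮i⟯ L := ⟨⟩
  by_contra htop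
  have hcard : Nat.card Gal(L/F⟮i⟯) ≠ 1 := by
    rw [IsGalois.card_aut_eq_finrank]
    intro h
    exact htop (IntermediateField.finrank_eq_one_iff_eq_top.1 h)
  obtain ⟨p, hp, hdvd⟩ := Nat.exists_prime_and_dvd hcard
  have := Fact.mk hp
  obtain ⟨σ, hσ⟩ := exists_prime_orderOf_dvd_card' p hdvd
  let f : Gal(L/F⟮i⟯) →* RingAut L :=
    { toFun := fun τ => τ.toRingEquiv
      map_one' := rfl
      map_mul' := fun _ _ => rfl }
  have hf : Function.Injective f := fun a b hab => AlgEquiv.ext fun x => RingEquiv.congr_fun hab x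
  refine RingAut.orderOf_ne_prime_of_apply_eq (f σ) hp hi ?_ ((orderOf_injective f hf σ).trans hσ)
  exact σ.commutes ⟨i, mem_adjoin_simple_self F i⟩

-- Since `L = F(i)` has degree at most 2, there is no room for a proper intermediate field.
open IntermediateField in
theorem IntermediateField.adjoin_eq_top_of_notMem_range {F L : Type*} [Field F]
    [Field L] [Algebra F L] [FiniteDimensional F L] [IsAlgClosed L] {α : L}
    (hα : α ∉ (algebraMap F L).range) : F⟮α⟯ = ⊤ := by
  obtain ⟨i, hi⟩ := IsAlgClosed.exists_pow_nat_eq (-1 : L) two_pos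
  have htop : F⟮i⟯ = ⊤ := adjoin_sqrt_neg_one_eq_top (by rw [← hi, sq])
  have hfin : Module.finrank F L ≤ 2 := by
    rw [← IntermediateField.finrank_top', ← htop,
      IntermediateField.adjoin.finrank (Algebra.IsIntegral.isIntegral i)]
    refine (natDegree_le_of_dvd (minpoly.dvd F i (p := X ^ 2 + C 1) ?_)
      (X_pow_add_C_ne_zero two_pos _)).trans_eq natDegree_X_pow_add_C
    simp [hi]
  refine IntermediateField.eq_of_le_of_finrank_le le_top ?_
  rw [IntermediateField.finrank_top']
  refine hfin.trans ?_
  by_contra! h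
  have h1 : Module.finrank F F⟮α⟯ = 1 := by
    have : 0 < Module.finrank F F⟮α⟯ := Module.finrank_pos
    omega
  rw [IntermediateField.finrank_adjoin_simple_eq_one_iff] at h1
  exact hα h1

open IntermediateField in
theorem mul_self_ne_neg_one_of_notMem_range {F L : Type*} [Field F]
    [Field L] [Algebra F L] [FiniteDimensional F L] [IsAlgClosed L] {α : L}
    (hα : α ∉ (algebraMap F L).range) (r : F) : r * r ≠ -1 := by
  intro hr
  have htop : F⟮algebraMap F L r⟯ = ⊤ :=
    adjoin_sqrt_neg_one_eq_top (by rw [← map_mul, hr, map_neg, map_one])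
  have hbot : F⟮algebraMap F L r⟯ = ⊥ :=
    adjoin_simple_eq_bot_iff.2 (IntermediateField.algebraMap_mem _ r)
  have : α ∈ (⊥ : IntermediateField F L) := by
    rw [← hbot, htop]
    trivial
  exact hα this

/-! ### Polynomials without roots -/

theorem Polynomial.exists_dvd_sq_add_one_of_irreducible {F : Type*} (L : Type*)
    [Field F] [Field L] [Algebra F L] [FiniteDimensional F L] [IsAlgClosed L] {p : F[X]}
    (hp : Irreducible p) (hroot : ∀ r, ¬ p.IsRoot r) : ∃ q : F[X], p ∣ q ^ 2 + 1 := by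
  obtain ⟨α, hα⟩ := IsAlgClosed.exists_aeval_eq_zero L p hp.degree_pos.ne'
  have hmem : α ∉ (algebraMap F L).range := by
    rintro ⟨r, rfl⟩
    refine hroot r ?_
    rwa [aeval_algebraMap_apply, map_eq_zero] at hα
  obtain ⟨i, hi⟩ := IsAlgClosed.exists_pow_nat_eq (-1 : L) two_pos
  have hi' : i ∈ IntermediateField.adjoin F {α} := by
    rw [IntermediateField.adjoin_eq_top_of_notMem_range hmem]
    trivial
  obtain ⟨q, rfl⟩ : ∃ q : F[X], aeval α q = i := by
    rw [← IntermediateField.mem_toSubalgebra,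
      IntermediateField.adjoin_simple_toSubalgebra_of_isAlgebraic
      (Algebra.IsAlgebraic.isAlgebraic α), Algebra.adjoin_singleton_eq_range_aeval] at hi'
    exact hi'
  refine ⟨q, ?_⟩
  have h1 : minpoly F α ∣ q ^ 2 + 1 := minpoly.dvd F α (by simp [hi])
  have h2 : Associated (minpoly F α) p :=
    ((minpoly.irreducible (Algebra.IsIntegral.isIntegral α)).associated_of_dvd hp
      (minpoly.dvd F α hα))
  exact h2.symm.dvd.trans h1

/-- Hensel lifting. The Newton step `q - (q ^ 2 + 1) / (2 * q)` is made polynomial by replacing `1 /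
q` with `-q`, its value modulo `q ^ 2 + 1`; the error is then a multiple of `(q ^ 2 + 1) ^ 2`. -/
theorem Polynomial.exists_pow_dvd_sq_add_one {F : Type*} [Field F] (h2 : (2 : F) ≠ 0) {p : F[X]}
    (h : ∃ q : F[X], p ∣ q ^ 2 + 1) (k : ℕ) : ∃ q : F[X], p ^ k ∣ q ^ 2 + 1 := by
  induction k with
  | zero => exact ⟨0, by simp⟩
  | succ k ih =>
    rcases k.eq_zero_or_pos with rfl | hk
    · simpa using h
    obtain ⟨q, hq⟩ := ih
    refine ⟨q + (q ^ 2 + 1) * q * C 2⁻¹, ?_⟩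
    have hC : (C 2⁻¹ : F[X]) * 2 = 1 := by
      rw [show (2 : F[X]) = C 2 from rfl, ← C_mul, inv_mul_cancel₀ h2, C_1]
    have heq : (q + (q ^ 2 + 1) * q * C 2⁻¹) ^ 2 + 1
        = (q ^ 2 + 1) ^ 2 * (1 + q ^ 2 * C 2⁻¹ ^ 2) := by
      linear_combination (q ^ 2 * (q ^ 2 + 1)) * hC
    rw [heq]
    refine Dvd.dvd.mul_right (dvd_trans ?_ (pow_dvd_pow_of_dvd hq 2)) _
    rw [← pow_mul]
    exact pow_dvd_pow _ (by omega)

/-- A polynomial without roots divides a polynomial of the form `q ^ 2 + 1`. -/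
theorem Polynomial.exists_dvd_sq_add_one_of_forall_not_isRoot {F : Type*} (L : Type*)
    [Field F] [Field L] [Algebra F L] [FiniteDimensional F L] [IsAlgClosed L] (h2 : (2 : F) ≠ 0)
    (m : F[X]) (hroot : ∀ r, ¬ m.IsRoot r) : ∃ q : F[X], m ∣ q ^ 2 + 1 := by
  induction m using UniqueFactorizationMonoid.induction_on_coprime with
  | h0 => exact absurd (by simp) (hroot 0)
  | h1 hx => exact ⟨0, hx.dvd⟩
  | hpr k hp =>
    rcases k.eq_zero_or_pos with rfl | hk
    · exact ⟨0, by simp⟩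
    refine exists_pow_dvd_sq_add_one h2 (exists_dvd_sq_add_one_of_irreducible L hp.irreducible
      fun r hr => hroot r ?_) k
    rw [IsRoot.def, eval_pow, hr.eq_zero, zero_pow hk.ne']
  | @hcp a b hab ha hb =>
    obtain ⟨q₁, h₁⟩ := ha fun r hr => hroot r (by rw [IsRoot.def, eval_mul, hr.eq_zero, zero_mul])
    obtain ⟨q₂, h₂⟩ := hb fun r hr => hroot r (by rw [IsRoot.def, eval_mul, hr.eq_zero, mul_zero])
    obtain ⟨u, v, huv⟩ := hab.isCoprime
    have hco : IsCoprime a b := ⟨u, v, huv⟩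
    -- Chinese remainder: this is `q₁` modulo `a` and `q₂` modulo `b`.
    refine ⟨q₁ * (v * b) + q₂ * (u * a), hco.mul_dvd ?_ ?_⟩
    · have : (q₁ * (v * b) + q₂ * (u * a)) ^ 2 + 1 = (q₁ ^ 2 + 1)
          + a * (((q₂ - q₁) * u) * (q₁ * (v * b) + q₂ * (u * a) + q₁)) := by
        rw [show v * b = 1 - u * a by rw [← huv]; ring]; ring
      rw [this]
      exact dvd_add h₁ (dvd_mul_right _ _)
    · have : (q₁ * (v * b) + q₂ * (u * a)) ^ 2 + 1 = (q₂ ^ 2 + 1)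
          + b * (((q₁ - q₂) * v) * (q₁ * (v * b) + q₂ * (u * a) + q₂)) := by
        rw [show u * a = 1 - v * b by rw [← huv]; ring]; ring
      rw [this]
      exact dvd_add h₂ (dvd_mul_right _ _)

/-! ### Common neighbours of rank-one matrices and complex structures -/

open Matrix in
theorem Matrix.exists_eq_smul_one_of_mem_center {n F : Type*} [Fintype n] [DecidableEq n] [Field F]
    {M : Matrix n n F} (hM : M ∈ Subring.center (Matrix n n F)) : ∃ a : F, M = a • 1 := by
  obtain ⟨a, ha⟩ := mem_range_scalar_of_commute_single (M := M)
    fun i j _ => Subring.mem_center_iff.1 hM _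
  exact ⟨a, by rw [← ha, scalar_apply, smul_one_eq_diagonal]⟩

open Matrix in
/-- A nonzero singular matrix is not central. -/
theorem Matrix.notMem_center_of_mulVec_eq_zero {n F : Type*} [Fintype n] [DecidableEq n] [Field F]
    {M : Matrix n n F} (hM : M ≠ 0) {w : n → F} (hw : w ≠ 0) (h : M *ᵥ w = 0) :
    M ∉ Subring.center (Matrix n n F) := by
  intro hc
  obtain ⟨a, rfl⟩ := exists_eq_smul_one_of_mem_center hc
  rw [smul_mulVec, one_mulVec, smul_eq_zero, or_iff_left hw] at h
  exact hM (by rw [h, zero_smul])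

open Matrix in
theorem Matrix.exists_ne_zero_dotProduct_eq_zero {n F : Type*} [Fintype n] [Field F]
    (hn : 3 ≤ Fintype.card n) (f g : n → F) : ∃ z : n → F, z ≠ 0 ∧ f ⬝ᵥ z = 0 ∧ g ⬝ᵥ z = 0 := by
  have hker : LinearMap.ker (Matrix.mulVecLin (Matrix.of ![f, g])) ≠ ⊥ := by
    apply LinearMap.ker_ne_bot_of_finrank_lt
    simp only [Module.finrank_fintype_fun_eq_card, Fintype.card_fin]
    omega
  obtain ⟨z, hz, hz0⟩ := Submodule.exists_mem_ne_zero_of_ne_bot hker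
  rw [LinearMap.mem_ker, mulVecLin_apply] at hz
  exact ⟨z, hz0, congrFun hz 0, congrFun hz 1⟩

open Matrix in
/-- Two matrices of rank one commute with a common noncentral matrix. -/
theorem Matrix.exists_notMem_center_commute_vecMulVec {n F : Type*} [Fintype n] [DecidableEq n]
    [Field F] (hn : 3 ≤ Fintype.card n) {x : n → F} (hx : x ≠ 0) (f y g : n → F) :
    ∃ W ∉ Subring.center (Matrix n n F),
      Commute (vecMulVec x f) W ∧ Commute W (vecMulVec y g) := by
  -- With these choices `vecMulVec z h` has zero product, on either side, with both given matrices.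
  obtain ⟨z, hz, hfz, hgz⟩ := exists_ne_zero_dotProduct_eq_zero hn f g
  obtain ⟨h, hh, hxh, hyh⟩ := exists_ne_zero_dotProduct_eq_zero hn x y
  rw [dotProduct_comm] at hxh hyh
  refine ⟨vecMulVec z h, notMem_center_of_mulVec_eq_zero (vecMulVec_ne_zero hz hh) hx ?_, ?_, ?_⟩
  · rw [vecMulVec_mulVec, hxh]; simp
  · rw [Commute, SemiconjBy, vecMulVec_mul_vecMulVec, vecMulVec_mul_vecMulVec, hfz, hxh]; simp
  · rw [Commute, SemiconjBy, vecMulVec_mul_vecMulVec, vecMulVec_mul_vecMulVec, hgz, hyh]; simp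

section ComplexStructure

variable {n F : Type*} [Fintype n] [DecidableEq n] [Field F] {J : Matrix n n F}

open Matrix in
theorem Matrix.eq_zero_of_mulVec_eq_smul (hF : ∀ r : F, r * r ≠ -1) (hJ : J * J = -1)
    {w : n → F} {r : F} (h : J *ᵥ w = r • w) : w = 0 := by
  have h1 : J *ᵥ (J *ᵥ w) = -w := by rw [mulVec_mulVec, hJ, neg_mulVec, one_mulVec]
  rw [h, mulVec_smul, h, smul_smul] at h1
  have h2 : (r * r + 1) • w = 0 := by rw [add_smul, h1, one_smul, neg_add_cancel]
  exact (smul_eq_zero.1 h2).resolve_left fun h3 => hF r (eq_neg_of_add_eq_zero_left h3)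

-- For `M = vecMulVec u f` this is `M + J * M * J⁻¹`, which commutes with `J`. Were it zero, a
-- column with `f j ≠ 0` would make `u` an eigenvector of `J`.
open Matrix in
theorem Matrix.vecMulVec_sub_vecMulVec_ne_zero (hF : ∀ r : F, r * r ≠ -1) (hJ : J * J = -1)
    {u f : n → F} (hu : u ≠ 0) (hf : f ≠ 0) :
    vecMulVec u f - vecMulVec (J *ᵥ u) (f ᵥ* J) ≠ 0 := by
  intro h
  obtain ⟨j, hj⟩ := Function.ne_iff.1 hf
  have h1 : f j • u = (f ᵥ* J) j • (J *ᵥ u) := by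
    ext i
    have := congrFun (congrFun h i) j
    simp only [sub_apply, vecMulVec_apply, zero_apply, sub_eq_zero] at this
    simpa [mul_comm] using this
  have h2 : (f ᵥ* J) j ≠ 0 := by
    intro h0
    rw [h0, zero_smul, smul_eq_zero] at h1
    exact h1.elim hj hu
  exact hu (eq_zero_of_mulVec_eq_smul hF hJ (r := ((f ᵥ* J) j)⁻¹ * f j)
    (by rw [mul_smul, h1, inv_smul_smul₀ h2]))

open Matrix in
/-- A matrix of rank one and a complex structure commute with a common noncentral matrix. -/
theorem Matrix.exists_notMem_center_commute_vecMulVec_of_mul_self (hn : 3 ≤ Fintype.card n)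
    (hF : ∀ r : F, r * r ≠ -1) (hJ : J * J = -1) {x : n → F} (hx : x ≠ 0) (f : n → F) :
    ∃ W ∉ Subring.center (Matrix n n F), Commute (vecMulVec x f) W ∧ Commute W J := by
  obtain ⟨z, hz, hfz, hgz⟩ := exists_ne_zero_dotProduct_eq_zero hn f (f ᵥ* J)
  obtain ⟨h, hh, hxh, hyh⟩ := exists_ne_zero_dotProduct_eq_zero hn x (J *ᵥ x)
  rw [dotProduct_comm] at hxh hyh
  rw [← dotProduct_mulVec] at hgz
  rw [dotProduct_mulVec] at hyh
  refine ⟨vecMulVec z h - vecMulVec (J *ᵥ z) (h ᵥ* J), notMem_center_of_mulVec_eq_zero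
    (vecMulVec_sub_vecMulVec_ne_zero hF hJ hz hh) hx ?_, ?_, ?_⟩
  · rw [sub_mulVec, vecMulVec_mulVec, vecMulVec_mulVec, hxh, hyh]; simp
  · rw [Commute, SemiconjBy, mul_sub, sub_mul]
    simp only [vecMulVec_mul_vecMulVec, hfz, hxh, hgz, hyh, zero_smul, vecMulVec_zero,
      sub_self]
  · rw [Commute, SemiconjBy, mul_sub, sub_mul]
    simp only [mul_vecMulVec, vecMulVec_mul, mulVec_mulVec, vecMul_vecMul, hJ, neg_mulVec,
      vecMul_neg, one_mulVec, vecMul_one, neg_vecMulVec, vecMulVec_neg]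
    abel

theorem commute_mul_add_mul_of_mul_self_eq_neg_one {R : Type*} [Ring R] {J K : R}
    (hJ : J * J = -1) (hK : K * K = -1) :
    Commute J (J * K + K * J) ∧ Commute (J * K + K * J) K := by
  constructor
  · have h1 : J * (J * K + K * J) = (J * J) * K + J * K * J := by noncomm_ring
    have h2 : (J * K + K * J) * J = J * K * J + K * (J * J) := by noncomm_ring
    rw [Commute, SemiconjBy, h1, h2, hJ]
    noncomm_ring
  · have h1 : K * (J * K + K * J) = (K * K) * J + K * J * K := by noncomm_ring
    have h2 : (J * K + K * J) * K = K * J * K + J * (K * K) := by noncomm_ring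
    rw [Commute, SemiconjBy, h1, h2, hK]
    noncomm_ring

/-- Supplies two candidates for a common neighbour of `J` and `Y`, with `T` free. `Y` anticommutes
with both `J` and `Y * T - T * Y`, so it commutes with their product. -/
theorem commute_of_anticommute {R : Type*} [Ring R] {J Y T : R}
    (hY : J * Y = -(Y * J)) (hT : J * T = -(T * J)) (hYT : Commute (Y * Y) T) :
    Commute J (Y * T + T * Y) ∧ Commute Y (Y * T + T * Y) ∧
      Commute J (J * (Y * T - T * Y)) ∧ Commute Y (J * (Y * T - T * Y)) := by
  have hJYT : Commute J (Y * T) := by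
    rw [Commute, SemiconjBy, ← mul_assoc, hY, neg_mul, mul_assoc, hT, mul_neg, neg_neg, mul_assoc]
  have hJTY : Commute J (T * Y) := by
    rw [Commute, SemiconjBy, ← mul_assoc, hT, neg_mul, mul_assoc, hY, mul_neg, neg_neg, mul_assoc]
  have hYT' : Y * Y * T = T * (Y * Y) := hYT
  refine ⟨hJYT.add_right hJTY, ?_, (Commute.refl J).mul_right (hJYT.sub_right hJTY), ?_⟩
  · rw [Commute, SemiconjBy, mul_add, add_mul, ← mul_assoc, hYT']
    noncomm_ring
  · have h1 : Y * J = -(J * Y) := by rw [hY, neg_neg]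
    have h2 : J * (Y * T - T * Y) * Y = J * (Y * T * Y) - J * (T * (Y * Y)) := by noncomm_ring
    rw [Commute, SemiconjBy, ← mul_assoc, h1, h2, ← hYT']
    noncomm_ring

open Matrix in
/-- A complex structure and a matrix anticommuting with it whose square is scalar commute with a
common noncentral matrix. -/
theorem Matrix.exists_notMem_center_commute_of_anticommute (hn : 3 ≤ Fintype.card n)
    (hF : ∀ r : F, r * r ≠ -1) (hJ : J * J = -1) {Y : Matrix n n F} (hY : J * Y = -(Y * J))
    (hYY : ∃ d : F, Y * Y = d • 1) :
    ∃ W ∉ Subring.center (Matrix n n F), Commute J W ∧ Commute W Y := by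
  have : Nonempty n := Fintype.card_pos_iff.1 (by omega)
  have h2 : (2 : F) ≠ 0 := fun h => hF 1 (by linear_combination h)
  have hJv : ∀ {w : n → F} {r : F}, J *ᵥ w = r • w → w = 0 := eq_zero_of_mulVec_eq_smul hF hJ
  rcases eq_or_ne Y 0 with rfl | hY0
  · refine ⟨J, fun hc => ?_, Commute.refl J, Commute.zero_right J⟩
    obtain ⟨a, ha⟩ := exists_eq_smul_one_of_mem_center hc
    refine one_ne_zero (α := n → F) (hJv (r := a) ?_)
    rw [ha, smul_mulVec, one_mulVec]
  obtain ⟨v, hv⟩ : ∃ v, Y *ᵥ v ≠ 0 := by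
    by_contra! h
    exact hY0 (Matrix.ext_of_mulVec_single fun i => by rw [h, zero_mulVec])
  have hv0 : v ≠ 0 := by
    rintro rfl
    exact hv (mulVec_zero Y)
  obtain ⟨w, hw, hw1, hw2⟩ := exists_ne_zero_dotProduct_eq_zero hn v (v ᵥ* J)
  -- `T` anticommutes with `J` and has rank at most 2, so it kills some `w ≠ 0`. If both candidates
  -- were scalars `s` and `r`, then `2 * Y * T = s - r * J`; applying this to `w` forces `r = s =
  -- 0`, against `Y * T ≠ 0`.
  set T := vecMulVec v v + J * vecMulVec v v * J with hTdef
  have hT : J * T = -(T * J) := by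
    have h3 : J * T = J * vecMulVec v v + (J * J) * vecMulVec v v * J := by
      rw [hTdef]; noncomm_ring
    have h4 : T * J = vecMulVec v v * J + J * vecMulVec v v * (J * J) := by
      rw [hTdef]; noncomm_ring
    rw [h3, h4, hJ]
    noncomm_ring
  have hTw : T *ᵥ w = 0 := by
    rw [hTdef, add_mulVec, mul_vecMulVec, vecMulVec_mul, vecMulVec_mulVec, vecMulVec_mulVec, hw1,
      hw2]
    simp
  have hYT : Y * T ≠ 0 := by
    have h3 : Y * T = vecMulVec (Y *ᵥ v) v - vecMulVec (J *ᵥ (Y *ᵥ v)) (v ᵥ* J) := by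
      rw [hTdef, mul_add, ← mul_assoc, ← mul_assoc, mulVec_mulVec, hY, neg_mulVec, neg_vecMulVec,
        mul_vecMulVec, mul_vecMulVec, vecMulVec_mul]
      abel
    rw [h3]
    exact vecMulVec_sub_vecMulVec_ne_zero hF hJ hv hv0
  obtain ⟨d, hd⟩ := hYY
  obtain ⟨c1, c2, c3, c4⟩ := commute_of_anticommute hY hT
    (by rw [hd]; exact (Commute.one_left T).smul_left d)
  by_cases hS : Y * T + T * Y ∈ Subring.center (Matrix n n F)
  swap
  · exact ⟨_, hS, c1, c2.symm⟩
  refine ⟨_, fun hR => ?_, c3, c4.symm⟩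
  obtain ⟨s, hs⟩ := exists_eq_smul_one_of_mem_center hS
  obtain ⟨r, hr⟩ := exists_eq_smul_one_of_mem_center hR
  have hU : Y * T - T * Y = -(r • J) := by
    have h3 : J * (J * (Y * T - T * Y)) = r • J := by rw [hr, mul_smul_comm, mul_one]
    rw [← mul_assoc, hJ, neg_mul, one_mul] at h3
    rw [← h3, neg_neg]
  have hYT2 : (2 : F) • (Y * T) = s • 1 - r • J := by
    rw [← hs, sub_eq_add_neg, ← hU, two_smul]
    abel
  have hw3 : r • (J *ᵥ w) = s • w := by
    have h3 := congrArg (· *ᵥ w) hYT2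
    simp only [smul_mulVec, ← mulVec_mulVec, hTw, mulVec_zero, smul_zero, sub_mulVec,
      one_mulVec] at h3
    exact (sub_eq_zero.1 h3.symm).symm
  have hr0 : r = 0 := by
    by_contra hr0
    refine hw (hJv (r := r⁻¹ * s) ?_)
    rw [mul_smul, ← hw3, inv_smul_smul₀ hr0]
  have hs0 : s = 0 := by
    rw [hr0, zero_smul, eq_comm, smul_eq_zero, or_iff_left hw] at hw3
    exact hw3
  rw [hr0, hs0, zero_smul, zero_smul, sub_zero, smul_eq_zero, or_iff_right h2] at hYT2
  exact hYT hYT2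

open Matrix in
/-- Two complex structures commute with a common noncentral matrix. -/
theorem Matrix.exists_notMem_center_commute_of_mul_self (hn : 3 ≤ Fintype.card n)
    (hF : ∀ r : F, r * r ≠ -1) (hJ : J * J = -1) {K : Matrix n n F} (hK : K * K = -1) :
    ∃ W ∉ Subring.center (Matrix n n F), Commute J W ∧ Commute W K := by
  have h2 : (2 : F) ≠ 0 := fun h => hF 1 (by linear_combination h)
  obtain ⟨c1, c2⟩ := commute_mul_add_mul_of_mul_self_eq_neg_one hJ hK
  by_cases hZ : J * K + K * J ∈ Subring.center (Matrix n n F)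
  swap
  · exact ⟨_, hZ, c1, c2⟩
  obtain ⟨c, hc⟩ := exists_eq_smul_one_of_mem_center hZ
  have hc' : K * J = c • 1 - J * K := by rw [← hc, add_sub_cancel_left]
  have hcc : c = 2⁻¹ * c + 2⁻¹ * c := by field_simp; ring
  -- When `J * K + K * J = c`, adding `(c / 2) * J` to `K` makes it anticommute with `J`, with
  -- scalar square.
  obtain ⟨W, hW, hJW, hWY⟩ := exists_notMem_center_commute_of_anticommute hn hF hJ
    (Y := K + (2⁻¹ * c) • J) (by
      rw [mul_add, add_mul, mul_smul_comm, smul_mul_assoc, hJ, hc']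
      nth_rewrite 2 [hcc]
      rw [add_smul, smul_neg]
      abel)
    ⟨-1 + (2⁻¹ * c) * (2⁻¹ * c), by
      rw [mul_add, add_mul, add_mul, mul_smul_comm, smul_mul_assoc, mul_smul_comm, smul_mul_assoc,
        hJ, hK, hc']
      match_scalars <;> field_simp <;> ring⟩
  refine ⟨W, hW, hJW, ?_⟩
  have := hWY.sub_right (hJW.symm.smul_right (2⁻¹ * c))
  rwa [add_sub_cancel_right] at this

end ComplexStructure

/-! ### Paths of length four -/

open Matrix in
/-- Over a subfield of finite codegree in an algebraically closed field, every square matrix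
commutes with a matrix of rank one or with a complex structure. -/
theorem Matrix.exists_commute_vecMulVec_or_mul_self {F : Type*} (L : Type*) {n : Type*} [Field F]
    [Field L] [Algebra F L] [FiniteDimensional F L] [IsAlgClosed L] [Fintype n] [DecidableEq n]
    [Nonempty n] (A : Matrix n n F) :
    (∃ x f : n → F, x ≠ 0 ∧ f ≠ 0 ∧ Commute A (vecMulVec x f)) ∨
      (∀ r : F, r * r ≠ -1) ∧ ∃ J : Matrix n n F, J * J = -1 ∧ Commute A J := by
  by_cases hroot : ∃ r, A.charpoly.IsRoot r
  · left
    obtain ⟨r, hr⟩ := hroot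
    rw [IsRoot.def, eval_charpoly] at hr
    obtain ⟨x, hx, hAx⟩ := exists_mulVec_eq_zero_iff.2 hr
    obtain ⟨f, hf, hfA⟩ := exists_vecMul_eq_zero_iff.2 hr
    refine ⟨x, f, hx, hf, ?_⟩
    rw [scalar_apply, ← smul_one_eq_diagonal] at hAx hfA
    rw [sub_mulVec, smul_mulVec, one_mulVec, sub_eq_zero] at hAx
    rw [vecMul_sub, vecMul_smul, vecMul_one, sub_eq_zero] at hfA
    rw [Commute, SemiconjBy, mul_vecMulVec, vecMulVec_mul, ← hAx, ← hfA, smul_vecMulVec,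
      vecMulVec_smul]
  · right
    push Not at hroot
    obtain ⟨α, hα⟩ := IsAlgClosed.exists_aeval_eq_zero L A.charpoly (by
      rw [charpoly_degree_eq_dim]
      exact_mod_cast Fintype.card_ne_zero)
    have hmem : α ∉ (algebraMap F L).range := by
      rintro ⟨r, rfl⟩
      rw [aeval_algebraMap_apply, map_eq_zero] at hα
      exact hroot r hα
    have hF := mul_self_ne_neg_one_of_notMem_range hmem
    have h2 : (2 : F) ≠ 0 := fun h => hF 1 (by linear_combination h)
    obtain ⟨q, hq⟩ := exists_dvd_sq_add_one_of_forall_not_isRoot L h2 A.charpoly hroot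
    refine ⟨hF, aeval A q, ?_, ?_⟩
    · have h3 : aeval A (q ^ 2 + 1) = 0 :=
        aeval_eq_zero_of_dvd_aeval_eq_zero hq (aeval_self_charpoly A)
      rw [map_add, map_pow, map_one, sq] at h3
      exact eq_neg_of_add_eq_zero_left h3
    · have := Commute.map (Commute.all X q) (aeval A)
      rwa [aeval_X] at this

open Matrix in
/-- Over a subfield of finite codegree in an algebraically closed field, any two noncentral square
matrices of size at least three are joined by a path of length four of commuting matrices. -/
theorem Matrix.exists_commute_path {F : Type*} (L : Type*) {n : Type*} [Field F]
    [Field L] [Algebra F L] [FiniteDimensional F L] [IsAlgClosed L] [Fintype n] [DecidableEq n]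
    (hn : 3 ≤ Fintype.card n) (A B : Matrix n n F) :
    ∃ X ∉ Subring.center (Matrix n n F), ∃ Z ∉ Subring.center (Matrix n n F),
      ∃ Y ∉ Subring.center (Matrix n n F),
        Commute A X ∧ Commute X Z ∧ Commute Z Y ∧ Commute Y B := by
  have : Nonempty n := Fintype.card_pos_iff.1 (by omega)
  have hrank : ∀ {x f : n → F}, x ≠ 0 → f ≠ 0 →
      vecMulVec x f ∉ Subring.center (Matrix n n F) := by
    intro x f hx hf
    obtain ⟨z, hz, hfz, -⟩ := exists_ne_zero_dotProduct_eq_zero hn f f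
    refine notMem_center_of_mulVec_eq_zero (vecMulVec_ne_zero hx hf) hz ?_
    rw [vecMulVec_mulVec, hfz]; simp
  have hcomplex : (∀ r : F, r * r ≠ -1) → ∀ {J : Matrix n n F}, J * J = -1 →
      J ∉ Subring.center (Matrix n n F) := by
    intro hF J hJ hc
    obtain ⟨a, rfl⟩ := exists_eq_smul_one_of_mem_center hc
    exact one_ne_zero (α := n → F) (eq_zero_of_mulVec_eq_smul hF hJ (r := a)
      (by rw [smul_mulVec, one_mulVec]))
  rcases exists_commute_vecMulVec_or_mul_self L A with ⟨x, f, hx, hf, hA⟩ | ⟨hF, J, hJ, hA⟩ <;>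
  rcases exists_commute_vecMulVec_or_mul_self L B with ⟨y, g, hy, hg, hB⟩ | ⟨hF', K, hK, hB⟩
  · obtain ⟨Z, hZ, h1, h2⟩ := exists_notMem_center_commute_vecMulVec hn hx f y g
    exact ⟨_, hrank hx hf, Z, hZ, _, hrank hy hg, hA, h1, h2, hB.symm⟩
  · obtain ⟨Z, hZ, h1, h2⟩ :=
      exists_notMem_center_commute_vecMulVec_of_mul_self hn hF' hK hx f
    exact ⟨_, hrank hx hf, Z, hZ, _, hcomplex hF' hK, hA, h1, h2, hB.symm⟩
  · obtain ⟨Z, hZ, h1, h2⟩ :=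
      exists_notMem_center_commute_vecMulVec_of_mul_self hn hF hJ hy g
    exact ⟨_, hcomplex hF hJ, Z, hZ, _, hrank hy hg, hA, h2.symm, h1.symm, hB.symm⟩
  · obtain ⟨Z, hZ, h1, h2⟩ := exists_notMem_center_commute_of_mul_self hn hF hJ hK
    exact ⟨_, hcomplex hF hJ, Z, hZ, _, hcomplex hF hK, hA, h1, h2, hB.symm⟩

/-! ### The nilpotent Jordan block and its centralizer -/

open Matrix in
/-- The nilpotent Jordan block: the matrix with ones on the superdiagonal. -/
def Matrix.upperShift (n : ℕ) (F : Type*) [Zero F] [One F] : Matrix (Fin n) (Fin n) F :=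
  Matrix.of fun i j => if (i : ℕ) + 1 = j then 1 else 0

open Matrix in
theorem Matrix.upperShift_mul_apply {n : ℕ} {F : Type*} [Field F] (P : Matrix (Fin n) (Fin n) F)
    (i j : Fin n) (hi : (i : ℕ) + 1 < n) : (upperShift n F * P) i j = P ⟨i + 1, hi⟩ j := by
  rw [mul_apply, Finset.sum_eq_single ⟨i + 1, hi⟩]
  · simp [upperShift]
  · intro k _ hk
    have : (i : ℕ) + 1 ≠ k := fun h => hk (Fin.ext h.symm)
    simp [upperShift, this]
  · simp

open Matrix in
theorem Matrix.mul_upperShift_apply_succ {n : ℕ} {F : Type*} [Field F]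
    (P : Matrix (Fin n) (Fin n) F) (i : Fin n) (j : ℕ) (hj : j + 1 < n) :
    (P * upperShift n F) i ⟨j + 1, hj⟩ = P i ⟨j, by omega⟩ := by
  rw [mul_apply, Finset.sum_eq_single ⟨j, by omega⟩]
  · simp [upperShift]
  · intro k _ hk
    have : (k : ℕ) ≠ j := fun h => hk (Fin.ext h)
    simp [upperShift, this]
  · simp

open Matrix in
theorem Matrix.mul_upperShift_apply_zero {n : ℕ} {F : Type*} [Field F]
    (P : Matrix (Fin n) (Fin n) F) (i : Fin n) (hn : 0 < n) :
    (P * upperShift n F) i ⟨0, hn⟩ = 0 := by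
  rw [mul_apply]
  exact Finset.sum_eq_zero fun k _ => by simp [upperShift]

open Matrix in
/-- A matrix commuting with the nilpotent Jordan block is an upper triangular Toeplitz matrix. -/
theorem Matrix.exists_toeplitz_of_commute_upperShift {n : ℕ} {F : Type*} [Field F]
    {P : Matrix (Fin n) (Fin n) F} (hP : Commute (upperShift n F) P) :
    ∃ p : ℕ → F, ∀ i j : Fin n, P i j = if i ≤ j then p (j - i) else 0 := by
  have hstep : ∀ i j (hi : i + 1 < n) (hj : j + 1 < n),
      P ⟨i + 1, hi⟩ ⟨j + 1, hj⟩ = P ⟨i, by omega⟩ ⟨j, by omega⟩ := by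
    intro i j hi hj
    rw [← upperShift_mul_apply P ⟨i, by omega⟩ _ hi, hP.eq, mul_upperShift_apply_succ]
  have hdiag : ∀ k i j (hi : i + k < n) (hj : j + k < n),
      P ⟨i + k, hi⟩ ⟨j + k, hj⟩ = P ⟨i, by omega⟩ ⟨j, by omega⟩ := by
    intro k
    induction k with
    | zero => intro i j hi hj; rfl
    | succ k ih =>
      intro i j hi hj
      rw [← ih i j (by omega) (by omega)]
      exact hstep (i + k) (j + k) hi hj
  refine ⟨fun k => if h : k < n then P ⟨0, by omega⟩ ⟨k, h⟩ else 0, fun i j => ?_⟩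
  obtain ⟨i, hi⟩ := i
  obtain ⟨j, hj⟩ := j
  by_cases hij : i ≤ j
  · obtain ⟨k, rfl⟩ := Nat.exists_eq_add_of_le' hij
    have h1 := hdiag i 0 k (by omega) hj
    have h2 : k < n := by omega
    simp only [zero_add] at h1
    simp [h1, h2]
  -- Below the diagonal, slide to column 0, which vanishes because column 0 of `P * upperShift n F`
  -- does.
  · obtain ⟨k, rfl⟩ := Nat.exists_eq_add_of_le' (show j + 1 ≤ i by omega)
    have h1 := hdiag j (k + 1) 0 (by omega) (by omega)
    have h2 := upperShift_mul_apply P ⟨k, by omega⟩ ⟨0, by omega⟩ (by simp; omega)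
    rw [hP.eq, mul_upperShift_apply_zero] at h2
    have h3 : P ⟨k + (j + 1), hi⟩ ⟨j, hj⟩ = 0 := by
      rw [h2, ← h1]
      congr 1 <;> ext <;> simp <;> omega
    rw [h3]
    exact (if_neg fun h => hij h).symm

open Matrix in
/-- A strictly upper triangular and a strictly lower triangular Toeplitz matrix do not commute, if
some nonzero diagonal of the first is at least as far out as some nonzero diagonal of the second. -/
theorem Matrix.not_commute_of_toeplitz {n : ℕ} {F : Type*} [Field F]
    {P Q : Matrix (Fin n) (Fin n) F} {p q : ℕ → F}
    (hP : ∀ i j : Fin n, P i j = if i ≤ j then p (j - i) else 0)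
    (hQ : ∀ i j : Fin n, Q i j = if j ≤ i then q (i - j) else 0)
    (hq0 : q 0 = 0) {k l : ℕ} (hl : l ≤ k) (hk : k < n) (hpk : p k ≠ 0) (hql : q l ≠ 0) :
    ¬ Commute P Q := by
  classical
  intro hc
  have hex : ∃ l, q l ≠ 0 := ⟨l, hql⟩
  have hex' : ∃ m, m + k < n ∧ p (n - 1 - m) ≠ 0 :=
    ⟨n - 1 - k, by omega, by rwa [show n - 1 - (n - 1 - k) = k by omega]⟩
  set l₀ := Nat.find hex with hl₀
  have hql₀ : q l₀ ≠ 0 := Nat.find_spec hex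
  have hlmin : ∀ t < l₀, q t = 0 := fun t ht => not_not.1 (Nat.find_min hex ht)
  have hl₀l : l₀ ≤ l := Nat.find_min' hex hql
  set m := Nat.find hex' with hm
  obtain ⟨hmk, hpm⟩ : m + k < n ∧ p (n - 1 - m) ≠ 0 := Nat.find_spec hex'
  have hmmin : ∀ t < m, p (n - 1 - t) = 0 := by
    intro t ht
    by_contra h
    exact Nat.find_min hex' ht ⟨by omega, h⟩
  -- `l₀` is the innermost nonzero diagonal of `Q` and `n - 1 - m` the outermost of `P`. At entry
  -- `(m + l₀, n - 1)`, `Q * P` has the single term `q l₀ * p (n - 1 - m)`, while `P * Q` vanishes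
  -- since `q 0 = 0`. The row index is in range because `l₀ ≤ l ≤ k`.
  have hentry := congrFun (congrFun hc.eq ⟨m + l₀, by omega⟩) ⟨n - 1, by omega⟩
  rw [mul_apply, mul_apply, Finset.sum_eq_zero, Finset.sum_eq_single ⟨m, by omega⟩] at hentry
  · rw [hP, hQ] at hentry
    simp only [Fin.mk_le_mk, le_add_iff_nonneg_right, zero_le, if_true,
      add_tsub_cancel_left] at hentry
    rw [if_pos (by omega)] at hentry
    exact mul_ne_zero hql₀ hpm hentry.symm
  · rintro ⟨j, hj⟩ - hjm
    have hjm' : j ≠ m := fun h => hjm (Fin.ext h)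
    rcases lt_or_gt_of_ne hjm' with h | h
    · rw [hP, if_pos (by simp; omega)]
      simp [hmmin j h]
    · rw [hQ]
      split_ifs with hle
      · rw [hlmin _ (by simp at hle ⊢; omega), zero_mul]
      · rw [zero_mul]
  · simp
  · rintro ⟨j, hj⟩ -
    rw [hQ ⟨j, hj⟩]
    split_ifs with hle
    · have : j = n - 1 := by simp at hle; omega
      simp [this, hq0]
    · rw [mul_zero]

open Matrix in
/-- A matrix commuting with the nilpotent Jordan block and a matrix commuting with its transpose
do not commute with each other, unless one of them is central. -/
theorem Matrix.not_commute_of_commute_upperShift {n : ℕ} {F : Type*} [Field F]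
    {P Q : Matrix (Fin n) (Fin n) F} (hP : Commute (upperShift n F) P)
    (hQ : Commute (upperShift n F)ᵀ Q) (hPc : P ∉ Subring.center (Matrix (Fin n) (Fin n) F))
    (hQc : Q ∉ Subring.center (Matrix (Fin n) (Fin n) F)) : ¬ Commute P Q := by
  intro hPQ
  have hQ' : Commute (upperShift n F) Qᵀ := by
    have := congrArg transpose hQ.eq
    rw [transpose_mul, transpose_mul, transpose_transpose] at this
    exact this.symm
  have key : ∀ {M : Matrix (Fin n) (Fin n) F}, Commute (upperShift n F) M →
      M ∉ Subring.center (Matrix (Fin n) (Fin n) F) → ∃ (a : F) (p : ℕ → F), p 0 = 0 ∧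
        (∃ k < n, p k ≠ 0) ∧ ∀ i j : Fin n, (M - a • 1) i j = if i ≤ j then p (j - i) else 0 := by
    intro M hM hMc
    obtain ⟨p, hp⟩ := exists_toeplitz_of_commute_upperShift hM
    have hentry : ∀ i j : Fin n, (M - p 0 • (1 : Matrix (Fin n) (Fin n) F)) i j =
        if i ≤ j then Function.update p 0 0 (j - i) else 0 := by
      intro i j
      rw [sub_apply, hp, smul_apply, one_apply]
      rcases lt_trichotomy i j with h | rfl | h
      · have : (j : ℕ) - i ≠ 0 := by have : (i : ℕ) < j := h; omega
        simp [h.le, h.ne, this]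
      · simp
      · simp [h.not_ge, h.ne']
    refine ⟨p 0, Function.update p 0 0, by simp, ?_, hentry⟩
    by_contra! h
    have h0 : M - p 0 • (1 : Matrix (Fin n) (Fin n) F) = 0 := by
      ext i j
      rw [hentry, h _ (by omega)]
      simp
    rw [sub_eq_zero] at h0
    refine hMc (Subring.mem_center_iff.2 fun g => ?_)
    rw [h0, mul_smul_comm, smul_mul_assoc, mul_one, one_mul]
  obtain ⟨a, p, hp0, ⟨k, hk, hpk⟩, hp⟩ := key hP hPc
  obtain ⟨b, q, hq0, ⟨l, hl, hql⟩, hq⟩ := key hQ' fun h => hQc (Subring.mem_center_iff.2 fun g => by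
    have := congrArg transpose (Subring.mem_center_iff.1 h gᵀ)
    simpa using this.symm)
  have hcomm : Commute (P - a • 1) (Q - b • 1) :=
    (hPQ.sub_right ((Commute.one_right P).smul_right b)).sub_left
      (((Commute.one_left _).smul_left a))
  have htr : (Q - b • (1 : Matrix (Fin n) (Fin n) F))ᵀ = Qᵀ - b • 1 := by simp
  -- Transposition exchanges the roles of `P` and `Q`, so either order of `k` and `l` is covered.
  rcases le_total l k with hlk | hlk
  · exact not_commute_of_toeplitz hp (fun i j => by rw [← transpose_apply (Q - b • 1), htr, hq])
      hq0 hlk hk hpk hql hcomm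
  · refine not_commute_of_toeplitz hq (Q := (P - a • 1)ᵀ) (fun i j => by rw [transpose_apply, hp])
      hp0 hlk hl hql hpk ?_
    have := congrArg transpose hcomm.eq
    rw [transpose_mul, transpose_mul, htr] at this
    exact this

/-! ### Distances in the commuting graph and the main theorem -/

/-- Commuting vertices of the commuting graph are at distance at most one. -/
theorem commutingGraph_edist_le_one {R : Type*} [Ring R] {a b : {a : R // a ∉ Subring.center R}}
    (h : Commute (a : R) b) : (commutingGraph R).edist a b ≤ 1 := by
  rw [SimpleGraph.edist_le_one_iff_adj_or_eq]
  by_cases hab : a = b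
  · exact Or.inr hab
  · exact Or.inl ⟨hab, h⟩

/-- Vertices of the commuting graph at distance at most three are the ends of a path of three
commuting pairs. -/
theorem exists_commute_of_commutingGraph_edist_lt {R : Type*} [Ring R]
    {a b : {a : R // a ∉ Subring.center R}} (h : (commutingGraph R).edist a b < 4) :
    ∃ p q : {a : R // a ∉ Subring.center R},
      Commute (a : R) p ∧ Commute (p : R) q ∧ Commute (q : R) b := by
  obtain ⟨w, hw⟩ := SimpleGraph.exists_walk_of_edist_ne_top (ne_top_of_lt h)
  rw [← hw] at h
  have hlen : w.length < 4 := by exact_mod_cast h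
  rcases w with _ | ⟨h1, _ | ⟨h2, _ | ⟨h3, _ | ⟨h4, w⟩⟩⟩⟩
  · exact ⟨a, a, Commute.refl _, Commute.refl _, Commute.refl _⟩
  · exact ⟨a, a, Commute.refl _, Commute.refl _, h1.2⟩
  · exact ⟨a, _, Commute.refl _, h1.2, h2.2⟩
  · exact ⟨_, _, h1.2, h2.2, h3.2⟩
  · simp only [SimpleGraph.Walk.length_cons] at hlen
    omega

open Matrix in
theorem Matrix.upperShift_notMem_center {n : ℕ} (F : Type*) [Field F] (hn : 2 ≤ n) :
    upperShift n F ∉ Subring.center (Matrix (Fin n) (Fin n) F) := by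
  intro hc
  obtain ⟨a, ha⟩ := exists_eq_smul_one_of_mem_center hc
  have := congrFun (congrFun ha ⟨0, by omega⟩) ⟨1, by omega⟩
  simp [upperShift] at this

theorem theorem1p1 (F : Type*) [Field F] (hF : FiniteDimensional F (AlgebraicClosure F))
    (n : ℕ) (hn : 3 ≤ n) :
    (commutingGraph (Matrix (Fin n) (Fin n) F)).Connected ∧
      (commutingGraph (Matrix (Fin n) (Fin n) F)).ediam = 4 := by
  have hcard : 3 ≤ Fintype.card (Fin n) := by rwa [Fintype.card_fin]
  have hle : (commutingGraph (Matrix (Fin n) (Fin n) F)).ediam ≤ 4 := by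
    refine SimpleGraph.ediam_le_of_edist_le fun A B => ?_
    obtain ⟨X, hX, Z, hZ, Y, hY, h1, h2, h3, h4⟩ :=
      Matrix.exists_commute_path (AlgebraicClosure F) hcard A.1 B.1
    have e1 := commutingGraph_edist_le_one (a := A) (b := ⟨X, hX⟩) h1
    have e2 := commutingGraph_edist_le_one (a := ⟨X, hX⟩) (b := ⟨Z, hZ⟩) h2
    have e3 := commutingGraph_edist_le_one (a := ⟨Z, hZ⟩) (b := ⟨Y, hY⟩) h3
    have e4 := commutingGraph_edist_le_one (a := ⟨Y, hY⟩) (b := B) h4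
    calc (commutingGraph (Matrix (Fin n) (Fin n) F)).edist A B
        ≤ _ + _ := SimpleGraph.edist_triangle
      _ ≤ 1 + (1 + (1 + 1)) := add_le_add e1 <| SimpleGraph.edist_triangle.trans <|
          add_le_add e2 <| SimpleGraph.edist_triangle.trans <| add_le_add e3 e4
      _ = 4 := by norm_num
  have hN : Matrix.upperShift n F ∉ Subring.center (Matrix (Fin n) (Fin n) F) :=
    Matrix.upperShift_notMem_center F (by omega)
  have hN' : (Matrix.upperShift n F).transpose ∉ Subring.center (Matrix (Fin n) (Fin n) F) := by
    intro h
    obtain ⟨a, ha⟩ := Matrix.exists_eq_smul_one_of_mem_center h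
    have := congrFun (congrFun ha ⟨1, by omega⟩) ⟨0, by omega⟩
    simp [Matrix.upperShift] at this
  have : Nonempty {A : Matrix (Fin n) (Fin n) F // A ∉ Subring.center _} := ⟨⟨_, hN⟩⟩
  refine ⟨SimpleGraph.connected_of_ediam_ne_top (ne_top_of_le_ne_top (by decide) hle),
    le_antisymm hle ?_⟩
  refine le_trans ?_ (SimpleGraph.edist_le_ediam (u := ⟨_, hN⟩) (v := ⟨_, hN'⟩))
  by_contra! hlt
  obtain ⟨P, Q, h1, h2, h3⟩ := exists_commute_of_commutingGraph_edist_lt hlt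
  exact Matrix.not_commute_of_commute_upperShift h1 h3.symm P.2 Q.2 h2
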